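/- All sequences $\mathbb M=(M_p)_{p\ge 0}$ consist of positive reals with $M_0=1$, and $m_p:=M_{p+1}/M_p$. $\mathbb M$ is *strongly regular* if (lc) $M_p^2\le M_{p-1}M_{p+1}$ for $p\ge1$; (mg) there is $A>0$ with $M_{p+q}\le A^{p+q}M_pM_q$ for all $p,q\ge 0$; (snq) there is $B>0$ with $\sum_{q\ge p}\frac{M_q}{(q+1)M_{q+1}}\le B\frac{M_p}{M_{p+1}}$ for all $p\ge0$. Two sequences are *equivalent*, $\mathbb M\approx\mathbb L$, if there are $C,D>0$ with $D^pL_p\le M_p\le C^pL_p$ for all $p$. Put $\omega(\mathbb M)=\liminf_{p\to\infty}\frac{\log m_p}{\log p}$, and let $\gamma(\mathbb M)$ be the supremum of all $\gamma>0$ for which there are a real sequence $(m'_p)$ and constants $c,d>0$ with $d\,m_p\le m'_p\le c\,m_p$ for all $p$ and $((p+1)^{-\gamma}m'_p)_p$ nondecreasing. Put $M(t)=\sup_{p\ge0}\log(t^p/M_p)$ and $d_{\mathbb M}(t)=\log M(t)/\log t$ for large $t$. A *nonzero proximate order* is a continuous function $\rho:(c,\infty)\to[0,\infty)$, for some $c\ge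 0$, which is differentiable except possibly at a sequence of points tending to infinity, at each of which it has distinct finite lateral derivatives, and which satisfies $\lim_{r\to\infty}\rho(r)\in(0,\infty)$ and $\lim_{r\to\infty}r\rho'(r)\log r=0$. A function defined for large $t$ is said to be a nonzero proximate order if it is one on some half-line $(c,\infty)$. $\mathbb M$ *admits a nonzero proximate order* if there are a nonzero proximate order $\rho$ and constants $A,B\in\mathbb R$ with $A\le\log(t)\,(\rho(t)-d_{\mathbb M}(t))\le B$ for all large $t$. **Statement.** There is a sequence $\mathbb M$ whose quotients are given by $m_0=m_1=1$, $m_2=2$ and, for $k\ge0$, $0\le j\le 2^k-1$ and $2^{2^k+j}<p\le 2^{2^k+j+1}$, $$m_p=4\,m_{2^{2^k+j}}\ \text{ if } j\le k-1,\qquad m_p=2^{\tau_k}\,m_{2^{2^k+j}}\ \text{ if } j\ge k,\qquad \tau_k=\frac{2^k-2k}{2^k-k}.$$ This $\mathbb M$ is strongly regular, $m_p\to\infty$, $\lim_{p\to\infty}\frac{\log m_p}{\log p}=1$ and $\gamma(\mathbb M)=\omega(\mathbb M)=1$, but $\mathbb M$ admits no nonzero proximate order. Moreover, there is no sequence $\mathbb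 L\approx\mathbb M$ (log-convex or not) for which $d_{\mathbb L}$ is a nonzero proximate order. -/

import Mathlib

open Filter Topology

noncomputable section

/-- The sequence of quotients `m_p = M_{p+1} / M_p`. -/
def quotSeq (M : ℕ → ℝ) (p : ℕ) : ℝ := M (p + 1) / M p

/-- A sequence of positive real numbers, normalized by `M_0 = 1`. -/
def IsWeightSeq (M : ℕ → ℝ) : Prop := M 0 = 1 ∧ ∀ p, 0 < M p

/-- Logarithmic convexity: `M_p ^ 2 ≤ M_{p-1} M_{p+1}` for all `p ≥ 1`. -/
def IsLogConvexSeq (M : ℕ → ℝ) : Prop :=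
  ∀ p, M (p + 1) ^ 2 ≤ M p * M (p + 2)

/-- Moderate growth. -/
def IsModerateGrowth (M : ℕ → ℝ) : Prop :=
  ∃ A : ℝ, 0 < A ∧ ∀ p q, M (p + q) ≤ A ^ (p + q) * M p * M q

/-- Strong non-quasianalyticity: for some `B > 0` and all `p`,
`∑_{q ≥ p} M_q / ((q+1) M_{q+1}) ≤ B M_p / M_{p+1}`, the series being convergent. -/
def IsStronglyNonQuasianalytic (M : ℕ → ℝ) : Prop :=
  ∃ B : ℝ, 0 < B ∧ ∀ p : ℕ,
    Summable (fun i : ℕ => M (p + i) / (((p + i : ℕ) + 1 : ℝ) * M (p + i + 1))) ∧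
    ∑' i : ℕ, M (p + i) / (((p + i : ℕ) + 1 : ℝ) * M (p + i + 1)) ≤ B * (M p / M (p + 1))

/-- Strongly regular sequences. -/
structure IsStronglyRegular (M : ℕ → ℝ) : Prop where
  weight : IsWeightSeq M
  logConvex : IsLogConvexSeq M
  moderateGrowth : IsModerateGrowth M
  snq : IsStronglyNonQuasianalytic M

/-- Equivalence `M ≈ L` of sequences: `D^p L_p ≤ M_p ≤ C^p L_p`. -/
def SeqEquiv (M L : ℕ → ℝ) : Prop :=
  ∃ C D : ℝ, 0 < C ∧ 0 < D ∧ ∀ p, D ^ p * L p ≤ M p ∧ M p ≤ C ^ p * L p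

/-- Equivalence `m ≃ l` of sequences of quotients: `d l_p ≤ m_p ≤ c l_p`. -/
def QuotEquiv (m l : ℕ → ℝ) : Prop :=
  ∃ c d : ℝ, 0 < c ∧ 0 < d ∧ ∀ p, d * l p ≤ m p ∧ m p ≤ c * l p

/-- The index `ω(M) = liminf log m_p / log p`, in `[-∞, ∞]`. -/
def omegaIndex (M : ℕ → ℝ) : EReal :=
  liminf (fun p : ℕ => ((Real.log (quotSeq M p) / Real.log p : ℝ) : EReal)) atTop

/-- Property `(P_γ)`: there is `m' ≃ m` with `(p+1)^{-γ} m'_p` increasing. -/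
def PropertyP (M : ℕ → ℝ) (γ : ℝ) : Prop :=
  ∃ m' : ℕ → ℝ, QuotEquiv m' (quotSeq M) ∧
    Monotone (fun p : ℕ => ((p : ℝ) + 1) ^ (-γ) * m' p)

/-- Thilliez's growth index `γ(M)`: the supremum, in `[-∞, ∞]`, of all `γ > 0` with `(P_γ)`. -/
def gammaIndex (M : ℕ → ℝ) : EReal :=
  sSup ((fun γ : ℝ => (γ : EReal)) '' {γ : ℝ | 0 < γ ∧ PropertyP M γ})

/-- The associated function `M(t) = sup_p log (t^p / M_p)`; the supremum is finite whenever
`M_p^{1/p} → ∞`, in particular for logarithmically convex `M` with quotients tending to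
infinity and for every sequence equivalent to such an `M`. -/
def assocFun (M : ℕ → ℝ) (t : ℝ) : ℝ := ⨆ p : ℕ, Real.log (t ^ p / M p)

/-- `d_M(t) = log M(t) / log t` (for large `t`). -/
def dFun (M : ℕ → ℝ) (t : ℝ) : ℝ := Real.log (assocFun M t) / Real.log t

/-- `ρ` is continuous on `(c, ∞)` and differentiable there except possibly at a sequence of
points tending to infinity (finitely many in every bounded set), at which it has distinct
finite lateral derivatives. -/
def IsPiecewiseDiffOn (ρ : ℝ → ℝ) (c : ℝ) : Prop :=
  ContinuousOn ρ (Set.Ioi c) ∧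
  ∃ S : Set ℝ, S ⊆ Set.Ioi c ∧ (∀ R : ℝ, (S ∩ Set.Iic R).Finite) ∧
    (∀ r, c < r → r ∉ S → DifferentiableAt ℝ ρ r) ∧
    ∀ r ∈ S, ∃ a b : ℝ, a ≠ b ∧
      HasDerivWithinAt ρ a (Set.Iio r) r ∧ HasDerivWithinAt ρ b (Set.Ioi r) r

/-- `ρ`, considered on `(c, ∞)`, is a proximate order with limit `ρ₀` at infinity. The limit
of `r ρ'(r) log r` is taken along the points where `ρ` is differentiable. -/
structure IsProximateOrderOn (ρ : ℝ → ℝ) (c ρ₀ : ℝ) : Prop where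
  piecewise : IsPiecewiseDiffOn ρ c
  nonneg : ∀ r, c < r → 0 ≤ ρ r
  tendsto : Tendsto ρ atTop (𝓝 ρ₀)
  tendsto_deriv : Tendsto (fun r => r * deriv ρ r * Real.log r)
    (atTop ⊓ 𝓟 {r | DifferentiableAt ℝ ρ r}) (𝓝 0)

/-- `ρ` is, on some half-line `(c, ∞)` with `c ≥ 0`, a proximate order with positive limit. -/
def IsNonzeroProximateOrder (ρ : ℝ → ℝ) : Prop :=
  ∃ c ρ₀ : ℝ, 0 ≤ c ∧ 0 < ρ₀ ∧ IsProximateOrderOn ρ c ρ₀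

/-- `M` admits a nonzero proximate order: for some nonzero proximate order `ρ`, the function
`log t (ρ(t) - d_M(t))` is bounded for large `t`. -/
def AdmitsNonzeroProximateOrder (M : ℕ → ℝ) : Prop :=
  ∃ ρ : ℝ → ℝ, IsNonzeroProximateOrder ρ ∧
    ∃ A B : ℝ, ∀ᶠ t : ℝ in atTop,
      A ≤ Real.log t * (ρ t - dFun M t) ∧ Real.log t * (ρ t - dFun M t) ≤ B

/-- The exponent `τ_k = (2^k - 2k) / (2^k - k)`. -/
def tauExp (k : ℕ) : ℝ := ((2 : ℝ) ^ k - 2 * k) / ((2 : ℝ) ^ k - k)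

/-- The recursion that determines the quotients `m`: `m_0 = m_1 = 1`, `m_2 = 2`, and on the
dyadic block `(2^{2^k+j}, 2^{2^k+j+1}]`, `0 ≤ j ≤ 2^k - 1`, the value of `m` is constant, equal
to `4 m_{2^{2^k+j}}` if `j ≤ k - 1` and to `2^{τ_k} m_{2^{2^k+j}}` if `j ≥ k`. -/
structure HasBlockQuotients (m : ℕ → ℝ) : Prop where
  zero : m 0 = 1
  one : m 1 = 1
  two : m 2 = 2
  fast : ∀ k j p : ℕ, j < k → p ∈ Set.Ioc (2 ^ (2 ^ k + j)) (2 ^ (2 ^ k + j + 1)) →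
    m p = 4 * m (2 ^ (2 ^ k + j))
  slow : ∀ k j p : ℕ, k ≤ j → j < 2 ^ k →
    p ∈ Set.Ioc (2 ^ (2 ^ k + j)) (2 ^ (2 ^ k + j + 1)) →
    m p = (2 : ℝ) ^ tauExp k * m (2 ^ (2 ^ k + j))

end

/-! Write `m_p = 2 ^ blockExp n` for `p` in `(2^(n-1), 2^n]`. In the stretch from `n = 2^k` to `n =
2^(k+1)` the exponent gains `2` in each of `k` steps, and `τ_k` is tuned so that the remaining steps
bring it back to `n` exactly (`blockExp_two_pow`). Hence `n ≤ blockExp n ≤ n + log₂ n`, which gives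
`log m_p / log p → 1` and `ω = 1`. The slopes are eventually above any `γ < 1`, so `(P_γ)` holds for
all `0 < γ < 1` (`propertyP_blockWeight`), and `γ = 1/2` already yields (snq).

The obstruction to proximate orders lies in the fast steps. By log-convexity and moderate growth,
`M(t)` is of order `N` for `t` near `m_N` (`assocFun_quotSeq_le`, `le_assocFun_two_mul_quotSeq`).
Over `j ≤ k` fast steps `log t` grows by `2j log 2` but `log M(t)` only by `j log 2 + O(1)`: slope
`1/2` on logarithmically long windows. For a proximate order, `ρ(t) log t` has derivative `tρ'(t)
log t + ρ(t) → ρ₀` in the variable `log t` (`IsProximateOrderOn.exists_le_sub`), and the values at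
`t ≈ 2^(2^k)` force `ρ₀ ≥ 1`. These slopes are incompatible. Bounded errors and dilations of `t` do
not matter, so `not_isNonzeroProximateOrder_of_between` covers both negative claims. -/

/-! ### Block exponents and their distance from linear growth -/

/-- The exponent by which the quotients grow, in base 2, on the block `(2 ^ n, 2 ^ (n + 1)]`. -/
noncomputable def blockSlope (n : ℕ) : ℝ :=
  if n - 2 ^ Nat.log 2 n < Nat.log 2 n then 2 else tauExp (Nat.log 2 n)

/-- The exponent, in base 2, of the quotient of index `2 ^ n`. -/
noncomputable def blockExp (n : ℕ) : ℝ := ∑ i ∈ Finset.range n, blockSlope i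

/-- The quotients that are constant on dyadic blocks. -/
noncomputable def blockQuot (p : ℕ) : ℝ := (2 : ℝ) ^ blockExp (Nat.clog 2 p)

/-- The sequence with quotients `blockQuot`. -/
noncomputable def blockWeight (p : ℕ) : ℝ := ∏ i ∈ Finset.range p, blockQuot i

theorem two_mul_le_two_pow (k : ℕ) : 2 * k ≤ 2 ^ k := by
  induction k with
  | zero => simp
  | succ k ih =>
    rcases Nat.eq_zero_or_pos k with rfl | hk
    · simp
    · rw [pow_succ]; omega

theorem two_mul_cast_le_two_pow (k : ℕ) : 2 * (k : ℝ) ≤ 2 ^ k := by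
  exact_mod_cast two_mul_le_two_pow k

theorem two_pow_sub_self_pos (k : ℕ) : 0 < (2 : ℝ) ^ k - k := by
  have : (k : ℝ) < 2 ^ k := by exact_mod_cast Nat.lt_two_pow_self
  linarith

theorem tauExp_nonneg (k : ℕ) : 0 ≤ tauExp k :=
  div_nonneg (by linarith [two_mul_cast_le_two_pow k]) (two_pow_sub_self_pos k).le

theorem tauExp_le_one (k : ℕ) : tauExp k ≤ 1 := by
  rw [tauExp, div_le_one (two_pow_sub_self_pos k)]
  linarith [Nat.cast_nonneg (α := ℝ) k]

theorem tauExp_mul (k : ℕ) : tauExp k * (2 ^ k - k) = 2 ^ k - 2 * k :=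
  div_mul_cancel₀ _ (two_pow_sub_self_pos k).ne'

theorem tendsto_tauExp : Tendsto tauExp atTop (𝓝 1) := by
  have h : Tendsto (fun k : ℕ => (k : ℝ) / 2 ^ k) atTop (𝓝 0) := by
    simpa using tendsto_pow_const_div_const_pow_of_one_lt 1 (one_lt_two (α := ℝ))
  have h2 : Tendsto (fun k : ℕ => (1 - 2 * ((k : ℝ) / 2 ^ k)) / (1 - (k : ℝ) / 2 ^ k)) atTop
      (𝓝 ((1 - 2 * 0) / (1 - 0))) :=
    (tendsto_const_nhds.sub (h.const_mul 2)).div (tendsto_const_nhds.sub h) (by norm_num)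
  have h3 : ((1 : ℝ) - 2 * 0) / (1 - 0) = 1 := by norm_num
  rw [h3] at h2
  refine h2.congr fun k => ?_
  have := two_pow_sub_self_pos k
  have h4 : (1 - (k : ℝ) / 2 ^ k) ≠ 0 := by
    rw [one_sub_div (by positivity)]
    positivity
  rw [tauExp]
  field_simp

theorem blockSlope_add (k j : ℕ) (hj : j < 2 ^ k) :
    blockSlope (2 ^ k + j) = if j < k then 2 else tauExp k := by
  have h : Nat.log 2 (2 ^ k + j) = k := by
    rw [Nat.log_eq_iff (Or.inr ⟨by norm_num, by positivity⟩), pow_succ]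
    omega
  simp [blockSlope, h]

theorem blockSlope_nonneg (n : ℕ) : 0 ≤ blockSlope n := by
  unfold blockSlope
  split_ifs
  · norm_num
  · exact tauExp_nonneg _

theorem blockSlope_le_two (n : ℕ) : blockSlope n ≤ 2 := by
  unfold blockSlope
  split_ifs
  · norm_num
  · linarith [tauExp_le_one (Nat.log 2 n)]

theorem eventually_lt_blockSlope {γ : ℝ} (hγ : γ < 1) : ∀ᶠ n in atTop, γ < blockSlope n := by
  have hlog : Tendsto (Nat.log 2) atTop atTop := by
    refine tendsto_atTop_atTop.2 fun b => ⟨2 ^ b, fun a ha => ?_⟩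
    exact Nat.le_log_of_pow_le (by norm_num) ha
  filter_upwards [(tendsto_tauExp.comp hlog).eventually (lt_mem_nhds hγ)] with n hn
  unfold blockSlope
  split_ifs
  · linarith
  · exact hn

theorem blockExp_succ (n : ℕ) : blockExp (n + 1) = blockExp n + blockSlope n :=
  Finset.sum_range_succ _ _

theorem blockExp_mono : Monotone blockExp :=
  monotone_nat_of_le_succ fun n => by
    rw [blockExp_succ]; linarith [blockSlope_nonneg n]

theorem blockExp_zero : blockExp 0 = 0 := Finset.sum_range_zero _

theorem blockExp_one : blockExp 1 = 1 := by
  rw [blockExp_succ, blockExp_zero]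
  -- At `n = 0` the conventions `Nat.log 2 0 = 0` and `0 - 1 = 0` select `tauExp 0 = 1`, the slope
  -- needed for `m_2 = 2`.
  simp [blockSlope, tauExp]

theorem blockExp_add_of_le {k j : ℕ} (hj : j ≤ k) :
    blockExp (2 ^ k + j) = blockExp (2 ^ k) + 2 * j := by
  induction j with
  | zero => simp
  | succ j ih =>
    have h1 : j < 2 ^ k := lt_of_lt_of_le hj Nat.lt_two_pow_self.le
    rw [← add_assoc, blockExp_succ, ih (by omega), blockSlope_add k j h1, if_pos (by omega)]
    push_cast
    ring

theorem blockExp_add_of_ge {k j : ℕ} (hj : k ≤ j) (hj2 : j ≤ 2 ^ k) :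
    blockExp (2 ^ k + j) = blockExp (2 ^ k) + 2 * k + (j - k) * tauExp k := by
  induction j, hj using Nat.le_induction with
  | base => simp [blockExp_add_of_le le_rfl]
  | succ j hkj ih =>
    rw [← add_assoc, blockExp_succ, ih (by omega), blockSlope_add k j (by omega),
      if_neg (by omega)]
    push_cast
    ring

theorem blockExp_two_pow (k : ℕ) : blockExp (2 ^ k) = 2 ^ k := by
  induction k with
  | zero => simpa using blockExp_one
  | succ k ih =>
    have h : k ≤ 2 ^ k := Nat.lt_two_pow_self.le
    have h2 := blockExp_add_of_ge h le_rfl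
    have h3 := tauExp_mul k
    rw [pow_succ 2 k, mul_two, h2, ih]
    push_cast
    rw [pow_succ]
    linarith

theorem exists_eq_two_pow_add {n : ℕ} (hn : n ≠ 0) :
    ∃ j < 2 ^ Nat.log 2 n, n = 2 ^ Nat.log 2 n + j := by
  have h1 := Nat.pow_log_le_self 2 hn
  have h2 := Nat.lt_pow_succ_log_self (b := 2) (by norm_num) n
  rw [pow_succ] at h2
  exact ⟨n - 2 ^ Nat.log 2 n, by omega, by omega⟩

/-- With `n = 2^k + j`, the excess `blockExp n - n` is `j` during the fast steps and `(2^k - j)(1 -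
τ_k)` afterwards: it rises to `k`, then falls linearly to `0`. -/
theorem le_blockExp (n : ℕ) : (n : ℝ) ≤ blockExp n := by
  rcases eq_or_ne n 0 with rfl | hn
  · simp [blockExp_zero]
  obtain ⟨j, hj, hnj⟩ := exists_eq_two_pow_add hn
  generalize Nat.log 2 n = k at hj hnj
  subst hnj
  rcases le_total j k with h | h
  · rw [blockExp_add_of_le h, blockExp_two_pow]
    push_cast
    linarith [Nat.cast_nonneg (α := ℝ) j]
  · rw [blockExp_add_of_ge h hj.le, blockExp_two_pow]
    have h3 := tauExp_mul k
    have h4 : (j : ℝ) ≤ 2 ^ k := by exact_mod_cast hj.le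
    push_cast
    nlinarith [mul_nonneg (sub_nonneg.2 h4) (sub_nonneg.2 (tauExp_le_one k))]

theorem blockExp_le (n : ℕ) : blockExp n ≤ n + Nat.log 2 n := by
  rcases eq_or_ne n 0 with rfl | hn
  · simp [blockExp_zero]
  obtain ⟨j, hj, hnj⟩ := exists_eq_two_pow_add hn
  generalize Nat.log 2 n = k at hj hnj
  subst hnj
  rcases le_total j k with h | h
  · rw [blockExp_add_of_le h, blockExp_two_pow]
    have : (j : ℝ) ≤ k := by exact_mod_cast h
    push_cast
    linarith
  · rw [blockExp_add_of_ge h hj.le, blockExp_two_pow]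
    have h4 : (k : ℝ) ≤ j := by exact_mod_cast h
    push_cast
    nlinarith [mul_nonneg (sub_nonneg.2 h4) (sub_nonneg.2 (tauExp_le_one k))]

/-! ### The quotients, log-convexity and moderate growth -/

theorem blockQuot_pos (p : ℕ) : 0 < blockQuot p := by unfold blockQuot; positivity

theorem blockQuot_mono : Monotone blockQuot := fun _ _ h =>
  Real.rpow_le_rpow_of_exponent_le (by norm_num) (blockExp_mono (Nat.clog_mono_right 2 h))

theorem blockQuot_two_pow (n : ℕ) : blockQuot (2 ^ n) = (2 : ℝ) ^ blockExp n := by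
  rw [blockQuot, Nat.clog_pow 2 n (by norm_num)]

theorem blockQuot_of_mem_Ioc {n p : ℕ} (hp : p ∈ Set.Ioc (2 ^ n) (2 ^ (n + 1))) :
    blockQuot p = (2 : ℝ) ^ blockSlope n * blockQuot (2 ^ n) := by
  have h : Nat.clog 2 p = n + 1 := by
    apply le_antisymm
    · exact Nat.clog_le_of_le_pow hp.2
    · exact (Nat.lt_clog_iff_pow_lt (by norm_num)).2 hp.1
  rw [blockQuot_two_pow, blockQuot, h, blockExp_succ, ← Real.rpow_add (by norm_num), add_comm]

theorem hasBlockQuotients_blockQuot : HasBlockQuotients blockQuot where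
  zero := by simp [blockQuot, blockExp_zero]
  one := by simp [blockQuot, blockExp_zero]
  two := by
    have := blockQuot_two_pow 1
    rw [blockExp_one] at this
    simpa using this
  fast k j p hj hp := by
    rw [blockQuot_of_mem_Ioc hp, blockSlope_add k j (hj.trans Nat.lt_two_pow_self), if_pos hj]
    norm_num
  slow k j p hk hj hp := by
    rw [blockQuot_of_mem_Ioc hp, blockSlope_add k j hj, if_neg (by omega)]

theorem clog_le_clog_add_two {p r : ℕ} (h : r ≤ 2 * p + 1) : Nat.clog 2 r ≤ Nat.clog 2 p + 2 := by
  refine Nat.clog_le_of_le_pow ?_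
  have h1 := Nat.le_pow_clog (b := 2) (by norm_num) p
  have h2 : 0 < 2 ^ Nat.clog 2 p := by positivity
  rw [pow_add]
  omega

/-- The index `r` is at most two blocks beyond `p`, and each block multiplies the quotient by at
most `2^2`. -/
theorem blockQuot_le_sixteen_mul {p r : ℕ} (h : r ≤ 2 * p + 1) :
    blockQuot r ≤ 16 * blockQuot p := by
  have h1 : blockExp (Nat.clog 2 r) ≤ 4 + blockExp (Nat.clog 2 p) := by
    refine (blockExp_mono (clog_le_clog_add_two h)).trans ?_
    rw [blockExp_succ, blockExp_succ]
    linarith [blockSlope_le_two (Nat.clog 2 p), blockSlope_le_two (Nat.clog 2 p + 1)]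
  calc blockQuot r ≤ (2 : ℝ) ^ (4 + blockExp (Nat.clog 2 p)) :=
        Real.rpow_le_rpow_of_exponent_le (by norm_num) h1
    _ = 16 * blockQuot p := by
        rw [Real.rpow_add (by norm_num), blockQuot]; norm_num

theorem blockWeight_zero : blockWeight 0 = 1 := Finset.prod_range_zero _

theorem blockWeight_succ (p : ℕ) : blockWeight (p + 1) = blockWeight p * blockQuot p :=
  Finset.prod_range_succ _ _

theorem blockWeight_pos (p : ℕ) : 0 < blockWeight p :=
  Finset.prod_pos fun i _ => blockQuot_pos i

theorem quotSeq_blockWeight : quotSeq blockWeight = blockQuot := by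
  funext p
  rw [quotSeq, blockWeight_succ, mul_div_cancel_left₀ _ (blockWeight_pos p).ne']

theorem blockWeight_isWeightSeq : IsWeightSeq blockWeight := ⟨blockWeight_zero, blockWeight_pos⟩

theorem blockWeight_isLogConvexSeq : IsLogConvexSeq blockWeight := fun p => by
  rw [blockWeight_succ (p + 1), blockWeight_succ p]
  have h := blockQuot_mono (Nat.le_succ p)
  have h1 := blockWeight_pos p
  have h2 := blockQuot_pos p
  calc (blockWeight p * blockQuot p) ^ 2
      = blockWeight p * (blockWeight p * blockQuot p * blockQuot p) := by ring
    _ ≤ blockWeight p * (blockWeight p * blockQuot p * blockQuot (p + 1)) := by gcongr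

theorem blockWeight_add_le (p q : ℕ) :
    blockWeight (p + q) ≤ 16 ^ (p + q) * blockWeight p * blockWeight q := by
  obtain ⟨n, hn⟩ : ∃ n, p + q = n := ⟨_, rfl⟩
  induction n generalizing p q with
  | zero =>
    obtain ⟨rfl, rfl⟩ : p = 0 ∧ q = 0 := by omega
    simp [blockWeight_zero]
  | succ n ih =>
    -- Lowering the larger index `p = r + 1` keeps `r + q ≤ 2r + 1`, so one factor `16` pays for the
    -- step.
    wlog hpq : q ≤ p generalizing p q with H
    · have := H q p (by omega) (by omega)
      rw [add_comm q p] at this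
      linarith
    obtain ⟨r, rfl⟩ : ∃ r, p = r + 1 := ⟨p - 1, by omega⟩
    have h1 := ih r q (by omega)
    have h2 : blockQuot (r + q) ≤ 16 * blockQuot r := blockQuot_le_sixteen_mul (by omega)
    have h3 := blockQuot_pos (r + q)
    have h4 := blockWeight_pos r
    have h5 := blockWeight_pos q
    rw [show r + 1 + q = r + q + 1 by ring, blockWeight_succ, blockWeight_succ]
    calc blockWeight (r + q) * blockQuot (r + q)
        ≤ (16 ^ (r + q) * blockWeight r * blockWeight q) * (16 * blockQuot r) := by gcongr
      _ = 16 ^ (r + q + 1) * (blockWeight r * blockQuot r) * blockWeight q := by ring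

theorem blockWeight_isModerateGrowth : IsModerateGrowth blockWeight :=
  ⟨16, by norm_num, blockWeight_add_le⟩

/-! ### Growth of the quotients and the two indices -/

theorem cast_le_blockQuot (p : ℕ) : (p : ℝ) ≤ blockQuot p := by
  have h1 : (p : ℝ) ≤ 2 ^ Nat.clog 2 p := by
    exact_mod_cast Nat.le_pow_clog (b := 2) (by norm_num) p
  refine h1.trans ?_
  rw [blockQuot, ← Real.rpow_natCast]
  exact Real.rpow_le_rpow_of_exponent_le (by norm_num) (le_blockExp _)

theorem tendsto_blockQuot : Tendsto blockQuot atTop atTop :=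
  tendsto_atTop_mono cast_le_blockQuot tendsto_natCast_atTop_atTop

theorem tendsto_clog_two : Tendsto (Nat.clog 2) atTop atTop := by
  refine tendsto_atTop_atTop.2 fun b => ⟨2 ^ b, fun a ha => ?_⟩
  calc b = Nat.clog 2 (2 ^ b) := (Nat.clog_pow 2 b (by norm_num)).symm
    _ ≤ Nat.clog 2 a := Nat.clog_mono_right 2 ha

theorem two_pow_clog_lt {p : ℕ} (hp : p ≠ 0) : 2 ^ Nat.clog 2 p < 2 * p := by
  rcases Nat.lt_or_ge 1 p with h | h
  · have h1 := Nat.pow_pred_clog_lt_self (b := 2) (by norm_num) h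
    have h2 : Nat.clog 2 p ≠ 0 := (Nat.clog_pos (by norm_num) h).ne'
    obtain ⟨n, hn⟩ := Nat.exists_eq_succ_of_ne_zero h2
    rw [hn] at h1 ⊢
    simp only [Nat.pred_succ] at h1
    rw [Nat.pow_succ]
    omega
  · obtain rfl : p = 1 := by omega
    simp

theorem tendsto_log_blockQuot_div_log :
    Tendsto (fun p : ℕ => Real.log (blockQuot p) / Real.log p) atTop (𝓝 1) := by
  have hlog : Tendsto (fun n : ℕ => (Nat.log 2 n : ℝ) / n) atTop (𝓝 0) := by
    have h1 : Tendsto (fun x : ℝ => Real.log x / x) atTop (𝓝 0) := by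
      simpa using Real.isLittleO_log_id_atTop.tendsto_div_nhds_zero
    have h2 := (h1.comp tendsto_natCast_atTop_atTop).div_const (Real.log 2)
    rw [zero_div] at h2
    refine squeeze_zero (fun n => by positivity) (fun n => ?_) h2
    have h3 : (Nat.log 2 n : ℝ) ≤ Real.logb 2 n := by
      simpa using Real.natLog_le_logb n 2
    calc (Nat.log 2 n : ℝ) / n ≤ Real.logb 2 n / n := by gcongr
      _ = _ := by simp [Real.logb, div_right_comm]
  have hinv : Tendsto (fun n : ℕ => (1 : ℝ) / n) atTop (𝓝 0) := tendsto_one_div_atTop_nhds_zero_nat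
  have hup : Tendsto (fun n : ℕ => (1 + (Nat.log 2 n : ℝ) / n) / (1 - 1 / n)) atTop (𝓝 1) := by
    have := (hlog.const_add 1).div (hinv.const_sub 1) (by norm_num)
    simpa [Pi.div_def] using this
  refine tendsto_of_tendsto_of_tendsto_of_le_of_le' tendsto_const_nhds
    (hup.comp tendsto_clog_two) ?_ ?_
  · filter_upwards [eventually_gt_atTop 1] with p hp
    have h1 : (1 : ℝ) < p := by exact_mod_cast hp
    rw [one_le_div (Real.log_pos h1)]
    exact Real.log_le_log (by linarith) (cast_le_blockQuot p)
  · filter_upwards [eventually_gt_atTop 1, tendsto_clog_two.eventually_gt_atTop 1] with p hp hn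
    have h1 : (1 : ℝ) < p := by exact_mod_cast hp
    have h2 : (1 : ℝ) < Nat.clog 2 p := by exact_mod_cast hn
    have h3 : ((2 : ℝ) ^ Nat.clog 2 p) ≤ 2 * p := by exact_mod_cast (two_pow_clog_lt (by omega)).le
    have h4 := blockExp_le (Nat.clog 2 p)
    simp only [Function.comp, blockQuot]
    generalize Nat.clog 2 p = n at *
    have hl2 : 0 < Real.log 2 := Real.log_pos (by norm_num)
    have h5 : ((n : ℝ) - 1) * Real.log 2 ≤ Real.log p := by
      have := Real.log_le_log (by positivity) h3
      rw [Real.log_pow, Real.log_mul (by norm_num) (by linarith)] at this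
      linarith
    have h6 : (1 + (Nat.log 2 n : ℝ) / n) / (1 - 1 / n) = (n + Nat.log 2 n) / (n - 1) := by
      have : (n : ℝ) - 1 ≠ 0 := by linarith
      have h0 : (n : ℝ) ≠ 0 := by linarith
      have : 1 - 1 / (n : ℝ) ≠ 0 := by rw [one_sub_div h0]; positivity
      field_simp
    rw [h6, Real.log_rpow (by norm_num)]
    have h7 : 0 < ((n : ℝ) - 1) * Real.log 2 := mul_pos (by linarith) hl2
    calc blockExp n * Real.log 2 / Real.log p
        ≤ ((n + Nat.log 2 n) * Real.log 2) / (((n : ℝ) - 1) * Real.log 2) := by gcongr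
      _ = _ := mul_div_mul_right _ _ hl2.ne'

/-- Only finitely many slopes lie below `γ`, so raising them to `γ` costs a bounded amount. This
produces the equivalent sequence for `(P_γ)`. -/
theorem exists_sum_max_blockSlope_le {γ : ℝ} (hγ : γ < 1) :
    ∃ K : ℝ, ∀ n, ∑ i ∈ Finset.range n, max (blockSlope i) γ ≤ blockExp n + K := by
  obtain ⟨N, hN⟩ := eventually_atTop.1 (eventually_lt_blockSlope hγ)
  refine ⟨N, fun n => ?_⟩
  have h : ∀ i, max (blockSlope i) γ - blockSlope i ≤ if i < N then 1 else 0 := fun i => by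
    split_ifs with hi
    · rw [sub_le_iff_le_add]
      exact max_le (by linarith) (by linarith [blockSlope_nonneg i])
    · rw [max_eq_left (hN i (by omega)).le, sub_self]
  have h2 := Finset.sum_le_sum fun i (_ : i ∈ Finset.range n) => h i
  rw [Finset.sum_sub_distrib, ← Finset.sum_filter, Finset.sum_const, nsmul_one] at h2
  have h3 : ((Finset.range n).filter (· < N)).card ≤ N := by
    calc _ ≤ (Finset.range N).card := Finset.card_le_card fun i hi => by
          simpa using (Finset.mem_filter.1 hi).2
      _ = N := Finset.card_range N
  have h4 : (((Finset.range n).filter (· < N)).card : ℝ) ≤ N := by exact_mod_cast h3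
  rw [blockExp]
  linarith

theorem propertyP_blockWeight {γ : ℝ} (h0 : 0 < γ) (h1 : γ < 1) : PropertyP blockWeight γ := by
  obtain ⟨K, hK⟩ := exists_sum_max_blockSlope_le h1
  set G : ℕ → ℝ := fun n => ∑ i ∈ Finset.range n, max (blockSlope i) γ with hG
  have hGg : ∀ n, blockExp n ≤ G n := fun n =>
    Finset.sum_le_sum fun i _ => le_max_left _ _
  have hmono : Monotone fun n : ℕ => G n - γ * n := by
    refine monotone_nat_of_le_succ fun n => ?_
    simp only [hG, Finset.sum_range_succ]
    push_cast
    linarith [le_max_right (blockSlope n) γ]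
  refine ⟨fun p => ((p : ℝ) + 1) ^ γ * 2 ^ (G (Nat.clog 2 p) - γ * Nat.clog 2 p),
    ⟨2 * 2 ^ K, 2⁻¹, by positivity, by norm_num, fun p => ?_⟩, fun p q hpq => ?_⟩
  · rw [quotSeq_blockWeight, blockQuot]
    beta_reduce
    have hp1 : (p : ℝ) + 1 ≤ 2 * 2 ^ Nat.clog 2 p := by
      have h2 := Nat.le_pow_clog (b := 2) (by norm_num) p
      have h3 : 0 < 2 ^ Nat.clog 2 p := by positivity
      exact_mod_cast (by omega : p + 1 ≤ 2 * 2 ^ Nat.clog 2 p)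
    have hp2 : (2 : ℝ) ^ Nat.clog 2 p ≤ 2 * (p + 1) := by
      rcases eq_or_ne p 0 with rfl | hp
      · norm_num
      · have h3 : (2 : ℝ) ^ Nat.clog 2 p < 2 * p := by exact_mod_cast two_pow_clog_lt hp
        linarith
    generalize Nat.clog 2 p = n at *
    have hγn : (2 : ℝ) ^ (γ * n) = ((2 : ℝ) ^ n) ^ γ := by
      rw [mul_comm, Real.rpow_mul (by norm_num), Real.rpow_natCast]
    have h2γ : (2 : ℝ) ^ γ ≤ 2 := by
      simpa using Real.rpow_le_rpow_of_exponent_le (one_le_two (α := ℝ)) h1.le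
    have hu : ((p : ℝ) + 1) ^ γ ≤ 2 * 2 ^ (γ * n) := by
      calc ((p : ℝ) + 1) ^ γ ≤ (2 * 2 ^ n) ^ γ := by gcongr
        _ = 2 ^ γ * 2 ^ (γ * n) := by rw [Real.mul_rpow (by norm_num) (by positivity), hγn]
        _ ≤ _ := by gcongr
    have hl : (2 : ℝ) ^ (γ * n) ≤ 2 * ((p : ℝ) + 1) ^ γ := by
      calc (2 : ℝ) ^ (γ * n) ≤ (2 * ((p : ℝ) + 1)) ^ γ := by rw [hγn]; gcongr
        _ = 2 ^ γ * ((p : ℝ) + 1) ^ γ := Real.mul_rpow (by norm_num) (by positivity)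
        _ ≤ _ := by gcongr
    have hGn : (2 : ℝ) ^ (G n) ≤ 2 ^ K * 2 ^ blockExp n := by
      rw [← Real.rpow_add (by norm_num), add_comm K]
      exact Real.rpow_le_rpow_of_exponent_le (by norm_num) (hK n)
    have hGn2 : (2 : ℝ) ^ blockExp n ≤ 2 ^ (G n) :=
      Real.rpow_le_rpow_of_exponent_le (by norm_num) (hGg n)
    rw [Real.rpow_sub (by norm_num)]
    have hpos : (0 : ℝ) < 2 ^ (γ * n) := by positivity
    constructor
    · rw [mul_div_assoc', le_div_iff₀ hpos]
      calc 2⁻¹ * (2 : ℝ) ^ blockExp n * 2 ^ (γ * n)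
          ≤ 2⁻¹ * 2 ^ (G n) * (2 * ((p : ℝ) + 1) ^ γ) := by gcongr
        _ = _ := by ring
    · rw [mul_div_assoc', div_le_iff₀ hpos]
      calc ((p : ℝ) + 1) ^ γ * 2 ^ (G n)
          ≤ (2 * 2 ^ (γ * n)) * (2 ^ K * 2 ^ blockExp n) := by gcongr
        _ = _ := by ring
  · have hcancel : ∀ r : ℕ, ∀ x : ℝ, ((r : ℝ) + 1) ^ (-γ) * (((r : ℝ) + 1) ^ γ * x) = x := by
      intro r x
      rw [← mul_assoc, ← Real.rpow_add (by positivity), neg_add_cancel, Real.rpow_zero, one_mul]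
    simp only [hcancel]
    exact Real.rpow_le_rpow_of_exponent_le (by norm_num) (hmono (Nat.clog_mono_right 2 hpq))

theorem le_one_of_propertyP_blockWeight {γ : ℝ} (h : PropertyP blockWeight γ) : γ ≤ 1 := by
  obtain ⟨m', ⟨c, d, hc, hd, hcd⟩, hmono⟩ := h
  rw [quotSeq_blockWeight] at hcd
  have h0 : 0 < m' 0 := lt_of_lt_of_le (mul_pos hd (blockQuot_pos 0)) (hcd 0).1
  by_contra! hγ
  -- Comparing index `p` with index `0` gives `m_p ≥ (m'_0 / c) p^γ`; this sequence is the resulting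
  -- lower bound for `log m_p / log p`.
  have hlim : Tendsto (fun p : ℕ => Real.log (m' 0 / c) / Real.log p + γ) atTop (𝓝 (0 + γ)) :=
    ((Real.tendsto_log_atTop.comp tendsto_natCast_atTop_atTop).const_div_atTop _).add_const γ
  rw [zero_add] at hlim
  refine absurd (le_of_tendsto_of_tendsto hlim tendsto_log_blockQuot_div_log ?_) hγ.not_ge
  filter_upwards [eventually_gt_atTop 1] with p hp
  have h1 : (1 : ℝ) < p := by exact_mod_cast hp
  have hlog := Real.log_pos h1
  have h2 : m' 0 ≤ ((p : ℝ) + 1) ^ (-γ) * m' p := by simpa using hmono (Nat.zero_le p)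
  have h3 : m' 0 * (p : ℝ) ^ γ ≤ c * blockQuot p := by
    calc m' 0 * (p : ℝ) ^ γ ≤ m' 0 * ((p : ℝ) + 1) ^ γ := by gcongr; linarith
      _ ≤ ((p : ℝ) + 1) ^ (-γ) * m' p * ((p : ℝ) + 1) ^ γ := by gcongr
      _ = m' p := by
        rw [mul_right_comm, ← Real.rpow_add (by positivity), neg_add_cancel, Real.rpow_zero,
          one_mul]
      _ ≤ _ := (hcd p).2
  have h4 : m' 0 / c * (p : ℝ) ^ γ ≤ blockQuot p := by
    rw [div_mul_eq_mul_div, div_le_iff₀ hc]; linarith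
  have h5 := Real.log_le_log (by positivity) h4
  rw [Real.log_mul (by positivity) (by positivity), Real.log_rpow (by linarith)] at h5
  rw [div_add' _ _ _ hlog.ne']
  gcongr

theorem gammaIndex_blockWeight : gammaIndex blockWeight = 1 := by
  apply le_antisymm
  · refine sSup_le ?_
    rintro _ ⟨γ, ⟨-, hγ⟩, rfl⟩
    exact EReal.coe_le_coe_iff.2 (le_one_of_propertyP_blockWeight hγ)
  · refine le_of_forall_lt fun x hx => ?_
    obtain ⟨y, hxy, hy⟩ := EReal.lt_iff_exists_real_btwn.1 hx
    have hy1 : y < 1 := by exact_mod_cast hy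
    have hpos : 0 < max y 2⁻¹ := lt_max_of_lt_right (by norm_num)
    have hmax : (y : EReal) ≤ (max y 2⁻¹ : ℝ) := EReal.coe_le_coe_iff.2 (le_max_left y 2⁻¹)
    exact hxy.trans_le (hmax.trans (le_sSup
      ⟨_, ⟨hpos, propertyP_blockWeight hpos (max_lt hy1 (by norm_num))⟩, rfl⟩))

theorem omegaIndex_blockWeight : omegaIndex blockWeight = 1 := by
  rw [omegaIndex, quotSeq_blockWeight]
  have h := (continuous_coe_real_ereal.tendsto 1).comp tendsto_log_blockQuot_div_log
  exact_mod_cast h.liminf_eq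

/-! ### Strong non-quasianalyticity -/

/-- A telescoping majorant of `x^(-3/2)`, which bounds the tails of the (snq) series. -/
theorem inv_mul_sqrt_le {x : ℝ} (hx : 1 ≤ x) :
    1 / (x * √x) ≤ 4 * (1 / √x - 1 / √(x + 1)) := by
  have h0 : 0 < √x := Real.sqrt_pos.2 (by linarith)
  have h1 : 0 < √(x + 1) := Real.sqrt_pos.2 (by linarith)
  have h2 : √x ^ 2 = x := Real.sq_sqrt (by linarith)
  have h3 : √(x + 1) ^ 2 = x + 1 := Real.sq_sqrt (by linarith)
  have h4 : √(x + 1) ≤ 3 / 2 * √x := by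
    rw [Real.sqrt_le_left (by positivity), mul_pow, h2]
    linarith
  rw [div_sub_div _ _ h0.ne' h1.ne', mul_div_assoc', div_le_div_iff₀ (by positivity) (by positivity)]
  have h5 : (√(x + 1) - √x) * (√(x + 1) + √x) = 1 := by nlinarith
  have h6 : 0 ≤ √(x + 1) - √x := sub_nonneg.2 (Real.sqrt_le_sqrt (by linarith))
  have h7 : 1 ≤ (√(x + 1) - √x) * (5 / 2 * √x) := by
    calc 1 = (√(x + 1) - √x) * (√(x + 1) + √x) := h5.symm
      _ ≤ _ := by gcongr; linarith
  have h8 : √(x + 1) ≤ 4 * (√(x + 1) - √x) * x := by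
    calc √(x + 1) ≤ 8 / 5 * √x * 1 := by linarith
      _ ≤ 8 / 5 * √x * ((√(x + 1) - √x) * (5 / 2 * √x)) := by gcongr
      _ = 4 * (√(x + 1) - √x) * √x ^ 2 := by ring
      _ = _ := by rw [h2]
  calc 1 * (√x * √(x + 1)) ≤ √x * (4 * (√(x + 1) - √x) * x) := by rw [one_mul]; gcongr
    _ = _ := by ring

/-- Property `(P_γ)` with `γ = 1 / 2` implies strong non-quasianalyticity. -/
theorem isStronglyNonQuasianalytic_of_propertyP {M : ℕ → ℝ} (hM : ∀ p, 0 < M p)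
    (hP : PropertyP M (1 / 2)) : IsStronglyNonQuasianalytic M := by
  obtain ⟨m', ⟨c, d, hc, hd, hcd⟩, hmono⟩ := hP
  have hquot : ∀ p, 0 < quotSeq M p := fun p => div_pos (hM _) (hM _)
  have hsqrt : ∀ r : ℕ, ((r : ℝ) + 1) ^ (-(1 / 2) : ℝ) = 1 / √((r : ℝ) + 1) := fun r => by
    rw [Real.rpow_neg (by positivity), ← Real.sqrt_eq_rpow, one_div]
  have key : ∀ p q : ℕ, p ≤ q →
      d * quotSeq M p * √((q : ℝ) + 1) ≤ c * quotSeq M q * √((p : ℝ) + 1) := by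
    intro p q hpq
    have h := hmono hpq
    simp only [hsqrt] at h
    have hp : 0 < √((p : ℝ) + 1) := by positivity
    have hq : 0 < √((q : ℝ) + 1) := by positivity
    rw [one_div_mul_eq_div, one_div_mul_eq_div, div_le_div_iff₀ hp hq] at h
    nlinarith [(hcd p).1, (hcd q).2]
  refine ⟨4 * (c / d), by positivity, fun p => ?_⟩
  set f : ℕ → ℝ := fun i => M (p + i) / (((p + i : ℕ) + 1 : ℝ) * M (p + i + 1)) with hf
  have hf0 : ∀ i, 0 ≤ f i := fun i => by
    have := hM (p + i)
    have := hM (p + i + 1)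
    positivity
  have hs : 0 < √((p : ℝ) + 1) := by positivity
  have hbound : ∀ i, f i ≤ c / d * (M p / M (p + 1)) * √((p : ℝ) + 1) *
      (4 * (1 / √((p : ℝ) + i + 1) - 1 / √((p : ℝ) + i + 1 + 1))) := by
    intro i
    have hk := key p (p + i) (Nat.le_add_right p i)
    have h1 := inv_mul_sqrt_le (x := (p : ℝ) + i + 1) (by
      linarith [Nat.cast_nonneg (α := ℝ) p, Nat.cast_nonneg (α := ℝ) i])
    have h2 : f i = 1 / (((p : ℝ) + i + 1) * quotSeq M (p + i)) := by
      have := (hM (p + i)).ne'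
      have := (hM (p + i + 1)).ne'
      simp only [hf, quotSeq]
      push_cast
      field_simp
    have h3 : M p / M (p + 1) = 1 / quotSeq M p := by simp [quotSeq]
    have hqp := hquot p
    have hqi := hquot (p + i)
    push_cast at hk
    calc f i ≤ c / d * (M p / M (p + 1)) * √((p : ℝ) + 1) *
          (1 / (((p : ℝ) + i + 1) * √((p : ℝ) + i + 1))) := by
          rw [h2, h3, div_mul_div_comm, div_mul_eq_mul_div, div_mul_div_comm,
            div_le_div_iff₀ (by positivity) (by positivity)]
          have : 0 ≤ (p : ℝ) + i + 1 := by positivity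
          nlinarith [mul_le_mul_of_nonneg_left hk this]
      _ ≤ _ := by have := hM p; have := hM (p + 1); gcongr
  have hsum : ∀ n, ∑ i ∈ Finset.range n, f i ≤ 4 * (c / d) * (M p / M (p + 1)) := by
    intro n
    refine (Finset.sum_le_sum fun i _ => hbound i).trans ?_
    rw [← Finset.mul_sum, ← Finset.mul_sum]
    have ht := Finset.sum_range_sub' (fun i : ℕ => 1 / √((p : ℝ) + i + 1)) n
    push_cast at ht
    simp only [← add_assoc, add_zero] at ht
    rw [ht]
    have h4 : 0 ≤ 1 / √((p : ℝ) + n + 1) := by positivity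
    have hMp := hM p
    have hMp1 := hM (p + 1)
    calc c / d * (M p / M (p + 1)) * √((p : ℝ) + 1) *
          (4 * (1 / √((p : ℝ) + 1) - 1 / √((p : ℝ) + n + 1)))
        ≤ c / d * (M p / M (p + 1)) * √((p : ℝ) + 1) * (4 * (1 / √((p : ℝ) + 1))) := by
          gcongr; linarith
      _ = 4 * (c / d) * (M p / M (p + 1)) := by field_simp
  exact ⟨summable_of_sum_range_le hf0 hsum, Real.tsum_le_of_sum_range_le hf0 hsum⟩

theorem blockWeight_isStronglyRegular : IsStronglyRegular blockWeight where
  weight := blockWeight_isWeightSeq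
  logConvex := blockWeight_isLogConvexSeq
  moderateGrowth := blockWeight_isModerateGrowth
  snq := isStronglyNonQuasianalytic_of_propertyP blockWeight_pos
    (propertyP_blockWeight (by norm_num) (by norm_num))

/-! ### The associated function of a log-convex sequence -/

theorem IsWeightSeq.quotSeq_pos {M : ℕ → ℝ} (hM : IsWeightSeq M) (p : ℕ) : 0 < quotSeq M p :=
  div_pos (hM.2 _) (hM.2 _)

theorem IsWeightSeq.apply_succ {M : ℕ → ℝ} (hM : IsWeightSeq M) (p : ℕ) :
    M (p + 1) = quotSeq M p * M p := (div_mul_cancel₀ _ (hM.2 p).ne').symm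

/-- At `t = m_N` the terms `t^p / M_p` increase up to `p = N` and decrease after it, since
consecutive ratios are `t / m_p`. -/
theorem quotSeq_pow_mul_le {M : ℕ → ℝ} (hM : IsWeightSeq M) (hmono : Monotone (quotSeq M))
    (N p : ℕ) : quotSeq M N ^ p * M N ≤ quotSeq M N ^ N * M p := by
  have hN := hM.quotSeq_pos N
  rcases le_total N p with h | h
  · induction p, h using Nat.le_induction with
    | base => exact le_rfl
    | succ p hp ih =>
      have h1 := hmono hp
      have h2 := hM.2 p
      rw [hM.apply_succ p]
      calc quotSeq M N ^ (p + 1) * M N = quotSeq M N * (quotSeq M N ^ p * M N) := by ring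
        _ ≤ quotSeq M p * (quotSeq M N ^ N * M p) := by
          have := hM.2 N
          have := hM.quotSeq_pos p
          gcongr
        _ = _ := by ring
  · induction h using Nat.decreasingInduction with
    | self => exact le_rfl
    | of_succ p hp ih =>
      have h1 := hmono hp.le
      have h2 := hM.2 p
      rw [hM.apply_succ p] at ih
      refine le_of_mul_le_mul_left ?_ hN
      calc quotSeq M N * (quotSeq M N ^ p * M N) = quotSeq M N ^ (p + 1) * M N := by ring
        _ ≤ quotSeq M N ^ N * (quotSeq M p * M p) := ih
        _ ≤ quotSeq M N ^ N * (quotSeq M N * M p) := by gcongr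
        _ = _ := by ring

theorem log_pow_div_le {M : ℕ → ℝ} (hM : IsWeightSeq M) (hmono : Monotone (quotSeq M))
    {t : ℝ} (ht : 0 < t) {N : ℕ} (htN : t ≤ quotSeq M N) (p : ℕ) :
    Real.log (t ^ p / M p) ≤ Real.log (quotSeq M N ^ N / M N) := by
  have h1 := hM.2 p
  refine Real.log_le_log (by positivity) ?_
  rw [div_le_div_iff₀ h1 (hM.2 N)]
  have := hM.2 N
  calc t ^ p * M N ≤ quotSeq M N ^ p * M N := by gcongr
    _ ≤ _ := quotSeq_pow_mul_le hM hmono N p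

theorem bddAbove_log_pow_div {M : ℕ → ℝ} (hM : IsWeightSeq M) (hmono : Monotone (quotSeq M))
    (hlim : Tendsto (quotSeq M) atTop atTop) {t : ℝ} (ht : 0 < t) :
    BddAbove (Set.range fun p : ℕ => Real.log (t ^ p / M p)) := by
  obtain ⟨N, hN⟩ := (hlim.eventually_ge_atTop t).exists
  exact ⟨_, Set.forall_mem_range.2 (log_pow_div_le hM hmono ht hN)⟩

theorem assocFun_quotSeq_le {M : ℕ → ℝ} (hM : IsWeightSeq M) (hmono : Monotone (quotSeq M))
    {A : ℝ} (hmg : ∀ p q, M (p + q) ≤ A ^ (p + q) * M p * M q) (N : ℕ) :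
    assocFun M (quotSeq M N) ≤ 2 * N * Real.log A := by
  have hN := hM.quotSeq_pos N
  have hMN := hM.2 N
  refine ciSup_le fun p => (log_pow_div_le hM hmono hN le_rfl p).trans ?_
  -- Index `2N` gives `m_N^N M_N ≤ M_{2N}`, and moderate growth bounds `M_{2N}` by `A^(2N) M_N^2`.
  have h1 := quotSeq_pow_mul_le hM hmono N (N + N)
  have h2 := hmg N N
  have h3 : quotSeq M N ^ N / M N ≤ A ^ (N + N) := by
    rw [div_le_iff₀ hMN]
    refine le_of_mul_le_mul_left ?_ (by positivity : 0 < quotSeq M N ^ N * M N)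
    calc quotSeq M N ^ N * M N * quotSeq M N ^ N = quotSeq M N ^ (N + N) * M N := by ring
      _ ≤ quotSeq M N ^ N * M (N + N) := h1
      _ ≤ quotSeq M N ^ N * (A ^ (N + N) * M N * M N) := by gcongr
      _ = _ := by ring
  calc Real.log (quotSeq M N ^ N / M N) ≤ Real.log (A ^ (N + N)) :=
        Real.log_le_log (by positivity) h3
    _ = 2 * N * Real.log A := by rw [Real.log_pow]; push_cast; ring

theorem le_assocFun_two_mul_quotSeq {M : ℕ → ℝ} (hM : IsWeightSeq M)
    (hmono : Monotone (quotSeq M)) (hlim : Tendsto (quotSeq M) atTop atTop) (N : ℕ) :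
    N * Real.log 2 ≤ assocFun M (2 * quotSeq M N) := by
  have hN := hM.quotSeq_pos N
  have hMN := hM.2 N
  refine le_trans ?_ (le_ciSup (bddAbove_log_pow_div hM hmono hlim (by positivity)) N)
  rw [← Real.log_pow]
  refine Real.log_le_log (by positivity) ?_
  rw [le_div_iff₀ hMN, mul_pow]
  -- Index `0` gives `M_N ≤ m_N^N`, so the term of index `N` at `t = 2 m_N` is at least `2^N`.
  have := quotSeq_pow_mul_le hM hmono N 0
  rw [hM.1, pow_zero, one_mul, mul_one] at this
  gcongr

theorem assocFun_mono {M : ℕ → ℝ} (hM : IsWeightSeq M) (hmono : Monotone (quotSeq M))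
    (hlim : Tendsto (quotSeq M) atTop atTop) {s t : ℝ} (hs : 0 < s) (hst : s ≤ t) :
    assocFun M s ≤ assocFun M t :=
  ciSup_mono (bddAbove_log_pow_div hM hmono hlim (hs.trans_le hst)) fun p => by
    have := hM.2 p
    exact Real.log_le_log (by positivity) (by gcongr)

theorem tendsto_assocFun {M : ℕ → ℝ} (hM : IsWeightSeq M) (hmono : Monotone (quotSeq M))
    (hlim : Tendsto (quotSeq M) atTop atTop) : Tendsto (assocFun M) atTop atTop := by
  refine tendsto_atTop.2 fun b => ?_
  obtain ⟨N, hN⟩ := exists_nat_ge (b / Real.log 2)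
  rw [div_le_iff₀ (Real.log_pos (by norm_num))] at hN
  filter_upwards [eventually_ge_atTop (2 * quotSeq M N)] with t ht
  exact (hN.trans (le_assocFun_two_mul_quotSeq hM hmono hlim N)).trans
    (assocFun_mono hM hmono hlim (mul_pos two_pos (hM.quotSeq_pos N)) ht)

/-- For equivalent sequences the associated functions are comparable up to dilations. -/
theorem assocFun_between_of_seqEquiv {M L : ℕ → ℝ} (hM : IsWeightSeq M)
    (hmono : Monotone (quotSeq M)) (hlim : Tendsto (quotSeq M) atTop atTop)
    (hL : IsWeightSeq L) (h : SeqEquiv M L) :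
    ∃ C D : ℝ, 0 < C ∧ 0 < D ∧
      ∀ t, 0 < t → assocFun M (D * t) ≤ assocFun L t ∧ assocFun L t ≤ assocFun M (C * t) := by
  obtain ⟨C, D, hC, hD, hCD⟩ := h
  refine ⟨C, D, hC, hD, fun t ht => ?_⟩
  have h1 : ∀ p, Real.log (t ^ p / L p) ≤ Real.log ((C * t) ^ p / M p) := fun p => by
    have h2 := hM.2 p
    have h3 := hL.2 p
    refine Real.log_le_log (by positivity) ?_
    rw [div_le_div_iff₀ h3 h2, mul_pow]
    calc t ^ p * M p ≤ t ^ p * (C ^ p * L p) := by gcongr; exact (hCD p).2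
      _ = _ := by ring
  have h4 : ∀ p, Real.log ((D * t) ^ p / M p) ≤ Real.log (t ^ p / L p) := fun p => by
    have h2 := hM.2 p
    have h3 := hL.2 p
    refine Real.log_le_log (by positivity) ?_
    rw [div_le_div_iff₀ h2 h3, mul_pow]
    calc D ^ p * t ^ p * L p = t ^ p * (D ^ p * L p) := by ring
      _ ≤ t ^ p * M p := by gcongr; exact (hCD p).1
  have hb := bddAbove_log_pow_div hM hmono hlim (mul_pos hC ht)
  -- `L` need not be log-convex, so finiteness of its supremum is inherited from `M`.
  have hbL : BddAbove (Set.range fun p : ℕ => Real.log (t ^ p / L p)) := by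
    obtain ⟨B, hB⟩ := hb
    exact ⟨B, Set.forall_mem_range.2 fun p => (h1 p).trans (hB ⟨p, rfl⟩)⟩
  exact ⟨ciSup_mono hbL h4, ciSup_mono hb h1⟩

/-! ### Growth of proximate orders -/

/-- A continuous function with nonnegative derivative off a finite set is monotone. -/
theorem le_of_deriv_nonneg_off_finite {F : ℝ → ℝ} {S : Set ℝ} {a b : ℝ} (hab : a ≤ b)
    (hc : ContinuousOn F (Set.Icc a b)) (hS : (S ∩ Set.Ioo a b).Finite)
    (hd : ∀ x ∈ Set.Ioo a b, x ∉ S → DifferentiableAt ℝ F x ∧ 0 ≤ deriv F x) : F a ≤ F b := by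
  obtain ⟨n, hn⟩ : ∃ n, (S ∩ Set.Ioo a b).ncard = n := ⟨_, rfl⟩
  induction n using Nat.strong_induction_on generalizing a b with
  | _ n ih =>
    rcases (S ∩ Set.Ioo a b).eq_empty_or_nonempty with he | ⟨c, hcS, hc1⟩
    · have hout : ∀ x ∈ Set.Ioo a b, x ∉ S := fun x hx hxS =>
        Set.notMem_empty x (he ▸ ⟨hxS, hx⟩)
      refine monotoneOn_of_deriv_nonneg (convex_Icc a b) hc ?_ ?_ (Set.left_mem_Icc.2 hab)
        (Set.right_mem_Icc.2 hab) hab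
      · rw [interior_Icc]
        exact fun x hx => (hd x hx (hout x hx)).1.differentiableWithinAt
      · rw [interior_Icc]
        exact fun x hx => (hd x hx (hout x hx)).2
    · have h1 : Set.Ioo a c ⊆ Set.Ioo a b := Set.Ioo_subset_Ioo_right hc1.2.le
      have h2 : Set.Ioo c b ⊆ Set.Ioo a b := Set.Ioo_subset_Ioo_left hc1.1.le
      have h3 := Set.inter_subset_inter_right S h1
      have h4 := Set.inter_subset_inter_right S h2
      have hcmem : c ∈ S ∩ Set.Ioo a b := ⟨hcS, hc1⟩
      have l1 : (S ∩ Set.Ioo a c).ncard < n := hn ▸ Set.ncard_lt_ncard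
        (h3.ssubset_of_mem_notMem hcmem fun h => lt_irrefl _ h.2.2) hS
      have l2 : (S ∩ Set.Ioo c b).ncard < n := hn ▸ Set.ncard_lt_ncard
        (h4.ssubset_of_mem_notMem hcmem fun h => lt_irrefl _ h.2.1) hS
      exact (ih _ l1 hc1.1.le (hc.mono (Set.Icc_subset_Icc_right hc1.2.le)) (hS.subset h3)
        (fun x hx => hd x (h1 hx)) rfl).trans
        (ih _ l2 hc1.2.le (hc.mono (Set.Icc_subset_Icc_left hc1.1.le)) (hS.subset h4)
        (fun x hx => hd x (h2 hx)) rfl)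

/-- If `ρ` is a proximate order with limit `ρ₀`, then `t ^ ρ t` grows at least like `t ^ σ` for
every `σ < ρ₀`. -/
theorem IsProximateOrderOn.exists_le_sub {ρ : ℝ → ℝ} {c ρ₀ σ : ℝ}
    (h : IsProximateOrderOn ρ c ρ₀) (hσ : σ < ρ₀) :
    ∃ R : ℝ, ∀ s t, R ≤ t → t ≤ s →
      σ * (Real.log s - Real.log t) ≤ ρ s * Real.log s - ρ t * Real.log t := by
  obtain ⟨hcont, S, -, hfin, hdiff, -⟩ := h.piecewise
  -- The sum `xρ'(x) log x + ρ(x)` is the derivative of `ρ(x) log x` with respect to `log x`.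
  have hlim := (h.tendsto_deriv.add (h.tendsto.mono_left inf_le_left)).eventually
    (lt_mem_nhds (by rwa [zero_add] : σ < 0 + ρ₀))
  rw [eventually_inf_principal] at hlim
  obtain ⟨R, hR⟩ := eventually_atTop.1 hlim
  refine ⟨max R (max (c + 1) 1), fun s t ht hts => ?_⟩
  have htR : R ≤ t := (le_max_left _ _).trans ht
  have htc : c + 1 ≤ t := ((le_max_left _ _).trans (le_max_right _ _)).trans ht
  have ht1 : 1 ≤ t := ((le_max_right _ _).trans (le_max_right _ _)).trans ht
  have hlog : ContinuousOn Real.log (Set.Icc t s) := fun x hx =>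
    (Real.continuousAt_log (by linarith [hx.1])).continuousWithinAt
  have hmain := le_of_deriv_nonneg_off_finite (S := S)
    (F := fun x => ρ x * Real.log x - σ * Real.log x) hts
    (((hcont.mono fun x hx => by
      simp only [Set.mem_Ioi]; linarith [hx.1]).mul hlog).sub (continuousOn_const.mul hlog))
    ((hfin s).subset fun x hx => ⟨hx.1, hx.2.2.le⟩)
    (fun x hx hxS => by
      have hx0 : 0 < x := by linarith [hx.1]
      have hρ := hdiff x (by linarith [hx.1]) hxS
      have hl := Real.hasDerivAt_log hx0.ne'
      have hder : HasDerivAt (fun x => ρ x * Real.log x - σ * Real.log x)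
          (deriv ρ x * Real.log x + ρ x * x⁻¹ - σ * x⁻¹) x :=
        (hρ.hasDerivAt.mul hl).sub (hl.const_mul σ)
      refine ⟨hder.differentiableAt, ?_⟩
      rw [hder.deriv]
      have h1 := hR x (htR.trans hx.1.le) hρ
      have h2 : deriv ρ x * Real.log x + ρ x * x⁻¹ - σ * x⁻¹
          = (x * deriv ρ x * Real.log x + ρ x - σ) * x⁻¹ := by field_simp
      rw [h2]
      exact mul_nonneg (by linarith) (by positivity))
  linarith

/-! ### The slope contradiction -/

theorem tendsto_quotSeq_blockWeight : Tendsto (quotSeq blockWeight) atTop atTop :=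
  quotSeq_blockWeight ▸ tendsto_blockQuot

theorem quotSeq_blockWeight_mono : Monotone (quotSeq blockWeight) :=
  quotSeq_blockWeight ▸ blockQuot_mono

theorem quotSeq_blockWeight_fast {k j : ℕ} (hj : j ≤ k) :
    quotSeq blockWeight (2 ^ (2 ^ k + j)) = 2 ^ 2 ^ k * 4 ^ j := by
  rw [quotSeq_blockWeight, blockQuot_two_pow, blockExp_add_of_le hj, blockExp_two_pow]
  have h : (2 : ℝ) ^ k + 2 * j = ((2 ^ k + 2 * j : ℕ) : ℝ) := by push_cast; ring
  rw [h, Real.rpow_natCast, pow_add, pow_mul]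
  norm_num

theorem le_log_assocFun_blockWeight (k : ℕ) :
    2 ^ k * Real.log 2 + Real.log (Real.log 2) ≤
      Real.log (assocFun blockWeight (2 * 2 ^ 2 ^ k)) := by
  have hl : 0 < Real.log 2 := Real.log_pos (by norm_num)
  have h := le_assocFun_two_mul_quotSeq blockWeight_isWeightSeq quotSeq_blockWeight_mono
    tendsto_quotSeq_blockWeight (2 ^ (2 ^ k + 0))
  rw [quotSeq_blockWeight_fast (Nat.zero_le k)] at h
  have h2 := Real.log_le_log (by positivity) h
  rw [Real.log_mul (by positivity) hl.ne'] at h2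
  simpa using h2

theorem log_assocFun_blockWeight_le {k j : ℕ} (hj : j ≤ k) :
    Real.log (assocFun blockWeight (2 ^ 2 ^ k * 4 ^ j)) ≤
      (2 ^ k + j) * Real.log 2 + Real.log (2 * Real.log 16) := by
  have hl : 0 < Real.log 2 := Real.log_pos (by norm_num)
  have hl16 : 0 < Real.log 16 := Real.log_pos (by norm_num)
  have h := assocFun_quotSeq_le blockWeight_isWeightSeq quotSeq_blockWeight_mono
    blockWeight_add_le (2 ^ (2 ^ k + j))
  rw [quotSeq_blockWeight_fast hj] at h
  have hpos : 0 < assocFun blockWeight (2 ^ 2 ^ k * 4 ^ j) := by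
    refine lt_of_lt_of_le ?_ ((le_assocFun_two_mul_quotSeq blockWeight_isWeightSeq
      quotSeq_blockWeight_mono tendsto_quotSeq_blockWeight 1).trans (assocFun_mono
      blockWeight_isWeightSeq quotSeq_blockWeight_mono tendsto_quotSeq_blockWeight
      (mul_pos two_pos (blockWeight_isWeightSeq.quotSeq_pos 1)) ?_))
    · simpa using hl
    · rw [quotSeq_blockWeight, hasBlockQuotients_blockQuot.one, mul_one]
      calc (2 : ℝ) = 2 ^ 1 * 1 := by norm_num
        _ ≤ 2 ^ 2 ^ k * 4 ^ j := by
          gcongr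
          · norm_num
          · exact Nat.one_le_two_pow
          · exact one_le_pow₀ (by norm_num)
  refine (Real.log_le_log hpos h).trans_eq ?_
  push_cast
  rw [mul_comm 2, mul_assoc, Real.log_mul (by positivity) (by positivity), Real.log_pow]
  push_cast
  ring

/-- No nonzero proximate order is, up to dilations and bounded factors, given by the associated
function of `blockWeight`. -/
theorem not_isNonzeroProximateOrder_of_between {ρ : ℝ → ℝ} {a b C D : ℝ} (hC : 0 < C) (hD : 0 < D)
    (hlow : ∀ᶠ t in atTop, a + Real.log (assocFun blockWeight (D * t)) ≤ ρ t * Real.log t)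
    (hup : ∀ᶠ t in atTop, ρ t * Real.log t ≤ b + Real.log (assocFun blockWeight (C * t))) :
    ¬ IsNonzeroProximateOrder ρ := by
  rintro ⟨c, ρ₀, -, -, h⟩
  have hl : 0 < Real.log 2 := Real.log_pos (by norm_num)
  have hx : Tendsto (fun k : ℕ => (2 : ℝ) ^ k * Real.log 2) atTop atTop :=
    (tendsto_pow_atTop_atTop_of_one_lt one_lt_two).atTop_mul_const hl
  have hpow : Tendsto (fun k : ℕ => (2 : ℝ) ^ 2 ^ k) atTop atTop :=
    (tendsto_pow_atTop_atTop_of_one_lt one_lt_two).comp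
      (tendsto_pow_atTop_atTop_of_one_lt one_lt_two)
  -- The points are scaled so that `D t = 2 m_N` with `N = 2^(2^k)`, where the lower bound for `M`
  -- applies.
  have ht : Tendsto (fun k : ℕ => 2 / D * (2 : ℝ) ^ 2 ^ k) atTop atTop :=
    hpow.const_mul_atTop (by positivity)
  have hDt : ∀ k : ℕ, D * (2 / D * (2 : ℝ) ^ 2 ^ k) = 2 * 2 ^ 2 ^ k := fun k => by field_simp
  have hlogt : ∀ k : ℕ, Real.log (2 / D * (2 : ℝ) ^ 2 ^ k)
      = Real.log (2 / D) + 2 ^ k * Real.log 2 := fun k => by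
    rw [Real.log_mul (by positivity) (by positivity), Real.log_pow]
    push_cast
    rfl
  have hρ₀ : 1 ≤ ρ₀ := by
    set β := Real.log (2 / D)
    set α := a + Real.log (Real.log 2)
    have hlim : Tendsto (fun k : ℕ => (α - β) / (β + 2 ^ k * Real.log 2) + 1) atTop (𝓝 (0 + 1)) :=
      ((tendsto_atTop_add_const_left _ β hx).const_div_atTop _).add_const 1
    rw [zero_add] at hlim
    refine le_of_tendsto_of_tendsto hlim (h.tendsto.comp ht) ?_
    filter_upwards [ht.eventually hlow, (tendsto_atTop_add_const_left _ β hx).eventually_gt_atTop 0]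
      with k hk hpos
    rw [hDt, hlogt] at hk
    rw [div_add_one hpos.ne', div_le_iff₀ hpos]
    simp only [Function.comp_apply]
    linarith [le_log_assocFun_blockWeight k]
  -- Any value strictly between the window slope `1/2` and `1 ≤ ρ₀` would do.
  obtain ⟨R, hR⟩ := h.exists_le_sub (σ := 3 / 4) (by linarith)
  have hJ1 : Tendsto (fun J : ℕ => (4 : ℝ) ^ J) atTop atTop :=
    tendsto_pow_atTop_atTop_of_one_lt (by norm_num)
  have hJ2 : Tendsto (fun J : ℕ => (J : ℝ) * (Real.log 2 / 2)) atTop atTop :=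
    tendsto_natCast_atTop_atTop.atTop_mul_const (by positivity)
  -- The window length `J` is fixed before `k`. The first condition orders the endpoints; in the
  -- second, `J log 2 / 2` is the gap between `(3/4) · 2J log 2` and `J log 2`, which must beat all
  -- constants.
  obtain ⟨J, hJge, hJgt⟩ := ((hJ1.eventually_ge_atTop (C * (2 / D))).and
    (hJ2.eventually_gt_atTop (b + Real.log (2 * Real.log 16) - a - Real.log (Real.log 2)
      + 3 / 4 * (Real.log (2 / D) + Real.log C)))).exists
  have hs : Tendsto (fun k : ℕ => 4 ^ J / C * (2 : ℝ) ^ 2 ^ k) atTop atTop :=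
    hpow.const_mul_atTop (by positivity)
  -- `J ≤ k` keeps the whole window inside the fast steps.
  obtain ⟨k, hkJ, hkR, hklow, hkup⟩ := ((eventually_ge_atTop J).and
    ((ht.eventually_ge_atTop R).and ((ht.eventually hlow).and (hs.eventually hup)))).exists
  have hCs : C * (4 ^ J / C * (2 : ℝ) ^ 2 ^ k) = 2 ^ 2 ^ k * 4 ^ J := by field_simp
  have hlogs : Real.log (4 ^ J / C * (2 : ℝ) ^ 2 ^ k)
      = J * (2 * Real.log 2) - Real.log C + 2 ^ k * Real.log 2 := by
    have h4 : Real.log 4 = 2 * Real.log 2 := by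
      rw [show (4 : ℝ) = 2 ^ 2 by norm_num, Real.log_pow]; norm_num
    rw [Real.log_mul (by positivity) (by positivity), Real.log_div (by positivity) hC.ne',
      Real.log_pow, Real.log_pow, h4]
    push_cast
    rfl
  have hts : 2 / D * (2 : ℝ) ^ 2 ^ k ≤ 4 ^ J / C * (2 : ℝ) ^ 2 ^ k := by
    have h1 : 2 / D ≤ 4 ^ J / C := by rw [le_div_iff₀ hC]; linarith
    exact mul_le_mul_of_nonneg_right h1 (by positivity)
  have hmain := hR _ _ hkR hts
  rw [hCs] at hkup
  rw [hDt] at hklow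
  have e1 := le_log_assocFun_blockWeight k
  have e2 := log_assocFun_blockWeight_le hkJ
  have e3 : 3 / 4 * (Real.log (4 ^ J / C * (2 : ℝ) ^ 2 ^ k) - Real.log (2 / D * (2 : ℝ) ^ 2 ^ k))
      = J * (3 / 2 * Real.log 2) - 3 / 4 * (Real.log (2 / D) + Real.log C) := by
    rw [hlogs, hlogt]; ring
  rw [e3] at hmain
  linarith

theorem not_admitsNonzeroProximateOrder_blockWeight :
    ¬ AdmitsNonzeroProximateOrder blockWeight := by
  rintro ⟨ρ, hρ, A, B, hAB⟩
  have hd : ∀ t : ℝ, 1 < t →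
      Real.log t * dFun blockWeight t = Real.log (assocFun blockWeight t) := fun t ht =>
    mul_div_cancel₀ _ (Real.log_pos ht).ne'
  refine not_isNonzeroProximateOrder_of_between (a := A) (b := B) one_pos one_pos ?_ ?_ hρ
  all_goals
    filter_upwards [hAB, eventually_gt_atTop 1] with t h ht
    rw [one_mul, ← hd t ht]
    linarith [h.1, h.2]

theorem not_isNonzeroProximateOrder_dFun_of_seqEquiv {L : ℕ → ℝ} (hL : IsWeightSeq L)
    (h : SeqEquiv blockWeight L) : ¬ IsNonzeroProximateOrder (dFun L) := by
  obtain ⟨C, D, hC, hD, hCD⟩ := assocFun_between_of_seqEquiv blockWeight_isWeightSeq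
    quotSeq_blockWeight_mono tendsto_quotSeq_blockWeight hL h
  have hpos : ∀ᶠ t in atTop, 0 < assocFun blockWeight (D * t) :=
    ((tendsto_assocFun blockWeight_isWeightSeq quotSeq_blockWeight_mono
      tendsto_quotSeq_blockWeight).comp (tendsto_id.const_mul_atTop hD)).eventually_gt_atTop 0
  refine not_isNonzeroProximateOrder_of_between (a := 0) (b := 0) hC hD ?_ ?_
  all_goals
    filter_upwards [hpos, eventually_gt_atTop 1] with t h0 ht
    have h1 := hCD t (by linarith)
    rw [dFun, div_mul_cancel₀ _ (Real.log_pos ht).ne', zero_add]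
  · exact Real.log_le_log h0 h1.1
  · exact Real.log_le_log (h0.trans_le h1.1) h1.2

theorem mainTheorem9 :
    ∃ M : ℕ → ℝ,
      HasBlockQuotients (quotSeq M) ∧
      IsStronglyRegular M ∧
      Tendsto (quotSeq M) atTop atTop ∧
      Tendsto (fun p : ℕ => Real.log (quotSeq M p) / Real.log p) atTop (𝓝 1) ∧
      gammaIndex M = 1 ∧
      omegaIndex M = 1 ∧
      ¬ AdmitsNonzeroProximateOrder M ∧
      (∀ L : ℕ → ℝ, IsWeightSeq L → SeqEquiv M L → ¬ IsNonzeroProximateOrder (dFun L)) := by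
  refine ⟨blockWeight, ?_, blockWeight_isStronglyRegular, tendsto_quotSeq_blockWeight, ?_,
    gammaIndex_blockWeight, omegaIndex_blockWeight, not_admitsNonzeroProximateOrder_blockWeight,
    fun L => not_isNonzeroProximateOrder_dFun_of_seqEquiv⟩
  · exact quotSeq_blockWeight ▸ hasBlockQuotients_blockQuot
  · simpa only [quotSeq_blockWeight] using tendsto_log_blockQuot_div_log
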